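/- Let $\phi:\mathbb R\to\mathbb R\cup\{+\infty\}$ be convex and lower semicontinuous with $\phi(1)=0$, and let $\operatorname{dom}\phi=\{\phi<\infty\}$ contain a neighbourhood of $1$. For probability measures $\mu,\nu$ on a measurable space $\Omega$, with Lebesgue decomposition $\mu=\mu_c+\mu_s$ ($\mu_c\ll\nu$, $\mu_s\perp\nu$), the $\phi$-divergence is $$D_\phi(\mu\|\nu)=\int\phi\Big(\frac{d\mu_c}{d\nu}\Big)\,d\nu+\mu_s(\Omega)\,\phi'(\infty),\qquad \phi'(\infty)=\lim_{x\to\infty}\frac{\phi(x)}{x},\qquad 0\cdot\infty=0,$$ and the total variation distance is $\mathrm{TV}(\mu,\nu)=\sup_g\big|\int g\,d\mu-\int g\,d\nu\big|$, the supremum being over all measurable $g:\Omega\to[-1,1]$. Let $\psi(x)=\phi(x+1)$, let $\psi^*(y)=\sup_{x\in\mathbb R}(xy-\psi(x))$ be its convex conjugate, and let $h$ be the height-for-width function of $\psi^*$: for $t\ge 0$, $h(t)$ is the infimum of all $y\in[0,\infty]$ such that the sublevel set $\{x\in\mathbb R:\psi^*(x)\le y\}$ has Lebesgue measure at least $t$.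 Suppose that $\phi$ is twice differentiable on the interior of $\operatorname{dom}\phi$ and that $\phi''$ is monotone (non-decreasing or non-increasing) there. Then $$h(t)\le\frac{t^2}{2\phi''(1)}\quad\text{for all }t\ge 0$$ (if $\phi''(1)=0$, the right-hand side is $+\infty$ for $t>0$ and $0$ for $t=0$). Equivalently, $$D_\phi(\mu\|\nu)\ \ge\ \frac{\phi''(1)}{8}\,\mathrm{TV}(\mu,\nu)^2\quad\text{for all probability measures }\mu,\nu.$$ In particular, for every $\alpha\in\mathbb R$ the $\alpha$-divergence, given by $$\phi_\alpha(x)=\frac{x^\alpha-\alpha(x-1)-1}{\alpha(\alpha-1)}\ (\alpha\ne 0,1),\qquad \phi_0(x)=x-1-\log x,\qquad \phi_1(x)=x\log x-x+1$$ for $x>0$, extended by its limit at $x=0$ (namely $1/\alpha$ if $\alpha>0$ and $+\infty$ if $\alpha\le0$) and by $+\infty$ for $x<0$, satisfies $$D_{\phi_\alpha}(\mu\|\nu)\ \ge\ \tfrac18\,\mathrm{TV}(\mu,\nu)^2\quad\text{for all probability measures }\mu,\nu.$$ -/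

import Mathlib

open MeasureTheory Set Filter
open scoped ENNReal

noncomputable section

/-- The effective domain of an extended-real-valued function on the line. -/
def effDom (f : ℝ → EReal) : Set ℝ := {x | f x < ⊤}

/-- A function `φ : ℝ → ℝ ∪ {+∞}` that is convex (i.e. has convex epigraph), lower semicontinuous,
and satisfies `φ 1 = 0`. -/
structure IsDivergenceGenerator (φ : ℝ → EReal) : Prop where
  ne_bot : ∀ x, φ x ≠ ⊥
  convex : Convex ℝ {p : ℝ × ℝ | φ p.1 ≤ (p.2 : EReal)}
  lsc : LowerSemicontinuous φ
  map_one : φ 1 = 0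

/-- `φ` is twice differentiable at every point of the interior of its domain. Near such a point `φ`
is real-valued, hence coincides there with `fun x => (φ x).toReal`. -/
def TwiceDifferentiableOnDom (φ : ℝ → EReal) : Prop :=
  ∀ x ∈ interior (effDom φ), DifferentiableAt ℝ (fun y => (φ y).toReal) x ∧
    DifferentiableAt ℝ (deriv fun y => (φ y).toReal) x

/-- The second derivative of `φ` (meaningful on the interior of its domain). -/
def secondDeriv (φ : ℝ → EReal) (x : ℝ) : ℝ := deriv (deriv fun y => (φ y).toReal) x

/-- The slope at infinity `φ'(∞) = lim_{x → +∞} φ(x) / x`. The limit exists for every proper convex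
`φ`, and is written here as an upper limit. -/
def slopeAtTop (φ : ℝ → EReal) : EReal := limsup (fun x : ℝ => φ x / (x : EReal)) atTop

variable {Ω : Type*} [MeasurableSpace Ω]

/-- The integral `∫ f dν` of an extended-real-valued function, as the integral of the positive part
minus the integral of the negative part. -/
def erealIntegral (ν : Measure Ω) (f : Ω → EReal) : EReal :=
  ((∫⁻ ω, (f ω).toENNReal ∂ν : ℝ≥0∞) : EReal) - ((∫⁻ ω, (-f ω).toENNReal ∂ν : ℝ≥0∞) : EReal)

/-- The `φ`-divergence `D_φ(μ ‖ ν) = ∫ φ(dμ_c/dν) dν + μ_s(Ω) φ'(∞)` of two measures, where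
`μ = μ_c + μ_s` is the Lebesgue decomposition of `μ` with respect to `ν` (and `0 * ∞ = 0`). -/
def phiDivergence (φ : ℝ → EReal) (μ ν : Measure Ω) : EReal :=
  erealIntegral ν (fun ω => φ (μ.rnDeriv ν ω).toReal) +
    ((μ.singularPart ν univ : ℝ≥0∞) : EReal) * slopeAtTop φ

/-- The total variation distance `sup_g |∫ g dμ - ∫ g dν|`, over all measurable `g : Ω → [-1, 1]`,
of two finite measures (so it takes values in `[0, 2]` on probability measures). -/
def tvDistance (μ ν : Measure Ω) : ℝ≥0∞ :=
  ⨆ g ∈ {g : Ω → ℝ | Measurable g ∧ ∀ ω, g ω ∈ Icc (-1 : ℝ) 1},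
    ENNReal.ofReal |∫ ω, g ω ∂μ - ∫ ω, g ω ∂ν|

/-- The convex conjugate `f*(y) = sup_x (x y - f(x))`. -/
def convexConj (f : ℝ → EReal) (y : ℝ) : EReal := ⨆ x : ℝ, ((x * y : ℝ) : EReal) - f x

/-- The sublevel set volume function: the Lebesgue measure of `{x | f x ≤ h}`. -/
def sublevelVolume (f : ℝ → EReal) (h : ℝ≥0∞) : ℝ≥0∞ := volume {x : ℝ | f x ≤ (h : EReal)}

/-- The height-for-width function: the right inverse `w ↦ inf {h | sublevelVolume f h ≥ w}`. -/
def heightForWidth (f : ℝ → EReal) (w : ℝ) : ℝ≥0∞ :=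
  sInf {h : ℝ≥0∞ | ENNReal.ofReal w ≤ sublevelVolume f h}

/-- The function `ψ(x) = φ(x + 1)`. -/
def shiftOne (φ : ℝ → EReal) (x : ℝ) : EReal := φ (x + 1)

/-- The generator `φ_α` of the `α`-divergence: `(x^α - α (x - 1) - 1) / (α (α - 1))` for `x > 0`,
with its limits `x - 1 - log x` for `α = 0` and `x log x - x + 1` for `α = 1`; at `x = 0` it is
extended by continuity (so it equals `1 / α` for `α > 0` and `+∞` for `α ≤ 0`), and it is `+∞` for
`x < 0`. -/
def alphaGenerator (α : ℝ) (x : ℝ) : EReal :=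
  if x < 0 ∨ (x = 0 ∧ α ≤ 0) then ⊤
  else if α = 0 then ((x - 1 - Real.log x : ℝ) : EReal)
  else if α = 1 then ((x * Real.log x - x + 1 : ℝ) : EReal)
  else (((x ^ α - α * (x - 1) - 1) / (α * (α - 1)) : ℝ) : EReal)

end

open MeasureTheory Set Filter Topology

/-! Monotonicity of `φ''` makes it at least `κ = φ''(1)` on one whole side of `1`. By Taylor's
formula `φ` lies there above the parabola `c (x - 1) + κ/2 (x - 1)^2` with `c = φ'(1)`; on the other
side convexity keeps it above the tangent. Both inequalities follow from this one-sided bound,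
`HasOneSidedQuadraticBound`.

Height: for slopes within `t` of `c`, on the side of the parabola, Young's inequality bounds `ψ*` by
`t^2 / (2κ)`, and the tangent controls the other half-line. A sublevel set thus contains an interval
of length `t`.

Divergence: this is proved directly, without passing through the height function. One side suffices
because the mass `u` that `μ` lacks relative to `ν` equals the mass it has in excess. Replacing the
parabola by its tangent line at distance `u` from `1` gives a piecewise affine minorant of `φ`,
which integrates to `κ u^2 / 2` (`le_phiDivergence_of_forall_le`), while `TV ≤ 2u`
(`tvDistance_le`).

For the `α`-divergence `φ'' = x^(α - 2)`, and the one-sided bound is checked by hand with `κ = 1`.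
-/

/-- A quadratic lower bound on a function of one variable whose second derivative is bounded below
on the segment joining the base point to the point of evaluation. -/
lemma quadratic_lower_bound_of_deriv2_ge {f f' f'' : ℝ → ℝ} {a x κ : ℝ}
    (hf : ∀ y ∈ uIcc a x, HasDerivAt f (f' y) y) (hf' : ∀ y ∈ uIcc a x, HasDerivAt f' (f'' y) y)
    (hκ : ∀ y ∈ uIcc a x, κ ≤ f'' y) :
    f a + f' a * (x - a) + κ / 2 * (x - a) ^ 2 ≤ f x := by
  have hmem : ∀ s ∈ Icc (0 : ℝ) 1, a + s * (x - a) ∈ uIcc a x := fun s hs => by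
    rw [← segment_eq_uIcc, segment_eq_image']
    exact ⟨s, hs, by simp⟩
  have hpath : ∀ s : ℝ, HasDerivAt (fun s => a + s * (x - a)) (x - a) s := fun s => by
    simpa using ((hasDerivAt_id s).mul_const (x - a)).const_add a
  -- Parametrizing the segment by `[0, 1]` treats both positions of `x` relative to `a` at once. `G`
  -- is `f` along the segment minus its linear and quadratic terms; `G'` is nondecreasing and
  -- vanishes at `0`, so `G` is nondecreasing.
  set G' : ℝ → ℝ := fun s => f' (a + s * (x - a)) * (x - a) - f' a * (x - a) - κ * (x - a) ^ 2 * s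
  set G : ℝ → ℝ := fun s =>
    f (a + s * (x - a)) - f' a * (x - a) * s - κ / 2 * (x - a) ^ 2 * s ^ 2
  have hG' : ∀ s ∈ Icc (0 : ℝ) 1,
      HasDerivAt G' ((f'' (a + s * (x - a)) - κ) * (x - a) ^ 2) s := fun s hs => by
    have h1 := (HasDerivAt.comp s (hf' _ (hmem s hs)) (hpath s)).mul_const (x - a)
    have h2 := (h1.sub_const (f' a * (x - a))).sub
      ((hasDerivAt_id s).const_mul (κ * (x - a) ^ 2))
    exact h2.congr_deriv (by ring)
  have hG : ∀ s ∈ Icc (0 : ℝ) 1, HasDerivAt G (G' s) s := fun s hs => by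
    have h1 := HasDerivAt.comp s (hf _ (hmem s hs)) (hpath s)
    have h2 := (h1.sub ((hasDerivAt_id s).const_mul (f' a * (x - a)))).sub
      ((hasDerivAt_pow 2 s).const_mul (κ / 2 * (x - a) ^ 2))
    exact h2.congr_deriv (by simp only [G']; push_cast; ring)
  have hG'mono : MonotoneOn G' (Icc 0 1) := by
    refine monotoneOn_of_hasDerivWithinAt_nonneg (convex_Icc 0 1)
      (fun s hs => (hG' s hs).continuousAt.continuousWithinAt)
      (fun s hs => (hG' s (interior_subset hs)).hasDerivWithinAt) fun s hs => ?_
    exact mul_nonneg (sub_nonneg.2 (hκ _ (hmem s (interior_subset hs)))) (sq_nonneg _)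
  have hGmono : MonotoneOn G (Icc 0 1) := by
    refine monotoneOn_of_hasDerivWithinAt_nonneg (convex_Icc 0 1)
      (fun s hs => (hG s hs).continuousAt.continuousWithinAt)
      (fun s hs => (hG s (interior_subset hs)).hasDerivWithinAt) fun s hs => ?_
    have := hG'mono (left_mem_Icc.2 zero_le_one) (interior_subset hs) (interior_subset hs).1
    simpa [G'] using this
  have := hGmono (left_mem_Icc.2 zero_le_one) (right_mem_Icc.2 zero_le_one) zero_le_one
  simp only [G, zero_mul, one_mul, mul_one, mul_zero, add_zero, add_sub_cancel] at this
  norm_num at this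
  linarith

/-! ### Tangent and parabola bounds for convex generators -/

section Generator

variable {φ : ℝ → EReal}

lemma IsDivergenceGenerator.coe_toReal (hφ : IsDivergenceGenerator φ) {x : ℝ}
    (hx : x ∈ effDom φ) : ((φ x).toReal : EReal) = φ x :=
  EReal.coe_toReal hx.ne (hφ.ne_bot x)

lemma IsDivergenceGenerator.convexOn (hφ : IsDivergenceGenerator φ) :
    ConvexOn ℝ (effDom φ) fun x => (φ x).toReal := by
  have key : ∀ x ∈ effDom φ, ∀ y ∈ effDom φ, ∀ a b : ℝ, 0 ≤ a → 0 ≤ b → a + b = 1 →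
      φ (a • x + b • y) ≤ ((a • (φ x).toReal + b • (φ y).toReal : ℝ) : EReal) := by
    intro x hx y hy a b ha hb hab
    exact hφ.convex (x := (x, (φ x).toReal)) (hφ.coe_toReal hx).ge
      (y := (y, (φ y).toReal)) (hφ.coe_toReal hy).ge ha hb hab
  have hconv : Convex ℝ (effDom φ) := fun x hx y hy a b ha hb hab =>
    (key x hx y hy a b ha hb hab).trans_lt (EReal.coe_lt_top _)
  refine ⟨hconv, fun x hx y hy a b ha hb hab => ?_⟩
  have h := key x hx y hy a b ha hb hab
  rwa [← hφ.coe_toReal (hconv hx hy ha hb hab), EReal.coe_le_coe_iff] at h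

lemma IsDivergenceGenerator.mem_interior_of_segment (hφ : IsDivergenceGenerator φ)
    (h1 : (1 : ℝ) ∈ interior (effDom φ)) {x : ℝ} (hx : x ∈ effDom φ) {θ : ℝ}
    (hθ : θ ∈ Ico (0 : ℝ) 1) : 1 + θ * (x - 1) ∈ interior (effDom φ) := by
  have := hφ.convexOn.1.combo_interior_self_mem_interior h1 hx
    (sub_pos.2 hθ.2) hθ.1 (sub_add_cancel 1 θ)
  simpa only [smul_eq_mul, mul_one, show (1 - θ) + θ * x = 1 + θ * (x - 1) by ring] using this

lemma IsDivergenceGenerator.toReal_segment_le (hφ : IsDivergenceGenerator φ)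
    (h1 : (1 : ℝ) ∈ interior (effDom φ)) {x : ℝ} (hx : x ∈ effDom φ) {θ : ℝ}
    (hθ : θ ∈ Ico (0 : ℝ) 1) : (φ (1 + θ * (x - 1))).toReal ≤ θ * (φ x).toReal := by
  have := hφ.convexOn.2 (interior_subset h1) hx (sub_pos.2 hθ.2).le hθ.1 (sub_add_cancel 1 θ)
  simp only [smul_eq_mul, hφ.map_one, EReal.toReal_zero, mul_zero, zero_add] at this
  rwa [show (1 - θ) * 1 + θ * x = 1 + θ * (x - 1) by ring] at this

lemma IsDivergenceGenerator.tangent_le (hφ : IsDivergenceGenerator φ)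
    (h1 : (1 : ℝ) ∈ interior (effDom φ)) (hd : TwiceDifferentiableOnDom φ) (x : ℝ) :
    ((deriv (fun y => (φ y).toReal) 1 * (x - 1) : ℝ) : EReal) ≤ φ x := by
  by_cases hx : x ∈ effDom φ
  swap
  · rw [not_lt_top_iff.1 (show ¬φ x < ⊤ from hx)]; exact le_top
  rw [← hφ.coe_toReal hx, EReal.coe_le_coe_iff]
  have hpath : HasDerivAt (fun s : ℝ => 1 + s * (x - 1)) (x - 1) 0 := by
    simpa using ((hasDerivAt_id (0 : ℝ)).mul_const (x - 1)).const_add 1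
  have hder : HasDerivAt (fun s : ℝ => (φ (1 + s * (x - 1))).toReal)
      (deriv (fun y => (φ y).toReal) 1 * (x - 1)) 0 := by
    have h := (hd 1 h1).1.hasDerivAt
    exact HasDerivAt.comp (h₂ := fun y => (φ y).toReal) 0 (by simpa using h) hpath
  have hlim := (hasDerivWithinAt_iff_tendsto_slope' self_notMem_Ioi).1
    (hder.hasDerivWithinAt (s := Ioi 0))
  refine le_of_tendsto hlim ?_
  filter_upwards [Ioo_mem_nhdsGT (zero_lt_one' ℝ)] with s hs
  rw [slope_def_field]
  simp only [zero_mul, add_zero, hφ.map_one, EReal.toReal_zero, sub_zero]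
  rw [div_le_iff₀ hs.1, mul_comm (φ x).toReal]
  exact hφ.toReal_segment_le h1 hx ⟨hs.1.le, hs.2⟩

lemma IsDivergenceGenerator.tangent_add_sq_le (hφ : IsDivergenceGenerator φ)
    (h1 : (1 : ℝ) ∈ interior (effDom φ)) (hd : TwiceDifferentiableOnDom φ) {x : ℝ}
    (hκ : ∀ y ∈ interior (effDom φ) ∩ uIcc 1 x, secondDeriv φ 1 ≤ secondDeriv φ y) :
    ((deriv (fun y => (φ y).toReal) 1 * (x - 1) + secondDeriv φ 1 / 2 * (x - 1) ^ 2 : ℝ) : EReal)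
      ≤ φ x := by
  by_cases hx : x ∈ effDom φ
  swap
  · rw [not_lt_top_iff.1 (show ¬φ x < ⊤ from hx)]; exact le_top
  rw [← hφ.coe_toReal hx, EReal.coe_le_coe_iff]
  set c := deriv (fun y => (φ y).toReal) 1
  -- `x` may be a boundary point of the domain, where `φ` need not be differentiable. Taylor's bound
  -- is applied at the interior point `1 + θ (x - 1)`, convexity bounds `φ` there by `θ φ(x)`, and
  -- after division by `θ` one lets `θ → 1`.
  have hseg : ∀ θ ∈ Ioo (0 : ℝ) 1,
      c * (x - 1) + secondDeriv φ 1 / 2 * (θ * (x - 1) ^ 2) ≤ (φ x).toReal := by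
    intro θ hθ
    have hint : uIcc 1 (1 + θ * (x - 1)) ⊆ interior (effDom φ) := by
      rw [← segment_eq_uIcc]
      exact hφ.convexOn.1.interior.segment_subset h1
        (hφ.mem_interior_of_segment h1 hx ⟨hθ.1.le, hθ.2⟩)
    have hsub : uIcc 1 (1 + θ * (x - 1)) ⊆ uIcc 1 x := by
      refine uIcc_subset_uIcc left_mem_uIcc ?_
      rw [← segment_eq_uIcc, segment_eq_image']
      exact ⟨θ, ⟨hθ.1.le, hθ.2.le⟩, by simp⟩
    have h2 := quadratic_lower_bound_of_deriv2_ge (f := fun y => (φ y).toReal)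
      (fun y hy => (hd y (hint hy)).1.hasDerivAt) (fun y hy => (hd y (hint hy)).2.hasDerivAt)
      (fun y hy => hκ y ⟨hint hy, hsub hy⟩)
    have h3 := h2.trans (hφ.toReal_segment_le h1 hx ⟨hθ.1.le, hθ.2⟩)
    simp only [hφ.map_one, EReal.toReal_zero] at h3
    refine le_of_mul_le_mul_left ?_ hθ.1
    linear_combination h3
  have hlim : Tendsto (fun θ : ℝ => c * (x - 1) + secondDeriv φ 1 / 2 * (θ * (x - 1) ^ 2))
      (𝓝[<] 1) (𝓝 (c * (x - 1) + secondDeriv φ 1 / 2 * (1 * (x - 1) ^ 2))) :=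
    (Continuous.tendsto (by fun_prop) 1).mono_left nhdsWithin_le_nhds
  rw [one_mul] at hlim
  refine le_of_tendsto hlim ?_
  filter_upwards [Ioo_mem_nhdsLT (zero_lt_one' ℝ)] with θ hθ using hseg θ hθ

end Generator

/-- The function `φ` lies above its tangent at `1` with slope `c`, and above the parabola with
second derivative `κ` tangent to that line at `1`, on at least one side of `1`. -/
structure HasOneSidedQuadraticBound (φ : ℝ → EReal) (c κ : ℝ) : Prop where
  tangent_le : ∀ x : ℝ, ((c * (x - 1) : ℝ) : EReal) ≤ φ x
  parabola_le :
    (∀ x : ℝ, 1 ≤ x → ((c * (x - 1) + κ / 2 * (x - 1) ^ 2 : ℝ) : EReal) ≤ φ x) ∨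
    (∀ x : ℝ, x ≤ 1 → ((c * (x - 1) + κ / 2 * (x - 1) ^ 2 : ℝ) : EReal) ≤ φ x)

lemma IsDivergenceGenerator.hasOneSidedQuadraticBound {φ : ℝ → EReal}
    (hφ : IsDivergenceGenerator φ) (h1 : (1 : ℝ) ∈ interior (effDom φ))
    (hd : TwiceDifferentiableOnDom φ)
    (hm : MonotoneOn (secondDeriv φ) (interior (effDom φ)) ∨
      AntitoneOn (secondDeriv φ) (interior (effDom φ))) :
    HasOneSidedQuadraticBound φ (deriv (fun y => (φ y).toReal) 1) (secondDeriv φ 1) := by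
  refine ⟨hφ.tangent_le h1 hd, hm.imp (fun hm x hx => ?_) fun hm x hx => ?_⟩
  · refine hφ.tangent_add_sq_le h1 hd fun y hy => hm h1 hy.1 ?_
    rw [uIcc_of_le hx] at hy
    exact hy.2.1
  · refine hφ.tangent_add_sq_le h1 hd fun y hy => hm hy.1 h1 ?_
    rw [uIcc_of_ge hx] at hy
    exact hy.2.2

/-! ### The conjugate and its height-for-width function -/

section Conjugate

variable {φ : ℝ → EReal} {c κ : ℝ}

lemma convexConj_le_coe {f : ℝ → EReal} {y b : ℝ}
    (h : ∀ x, ((x * y - b : ℝ) : EReal) ≤ f x) : convexConj f y ≤ (b : EReal) := by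
  refine iSup_le fun x => ?_
  calc ((x * y : ℝ) : EReal) - f x ≤ ((x * y : ℝ) : EReal) - ((x * y - b : ℝ) : EReal) :=
        EReal.sub_le_sub le_rfl (h x)
    _ = (b : EReal) := by rw [← EReal.coe_sub]; congr 1; ring

lemma HasOneSidedQuadraticBound.exists_Icc (h : HasOneSidedQuadraticBound φ c κ) (hκ : 0 < κ)
    {t : ℝ} (ht : 0 ≤ t) :
    ∃ a : ℝ, ∀ y ∈ Icc a (a + t),
      convexConj (shiftOne φ) y ≤ ((t ^ 2 / (2 * κ) : ℝ) : EReal) := by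
  -- Young's inequality, from `(κ x - y)^2 ≥ 0`.
  have key : ∀ x y : ℝ, |y| ≤ t → x * y - κ / 2 * x ^ 2 ≤ t ^ 2 / (2 * κ) := by
    intro x y hy
    rw [le_div_iff₀ (by positivity)]
    nlinarith [sq_nonneg (κ * x - y), sq_le_sq' (abs_le.1 hy).1 (abs_le.1 hy).2]
  have hb : 0 ≤ t ^ 2 / (2 * κ) := by positivity
  obtain hq | hq := h.parabola_le
  · refine ⟨c, fun y hy => convexConj_le_coe fun x => ?_⟩
    obtain hx | hx := le_total 0 x
    · refine le_trans (EReal.coe_le_coe_iff.2 ?_) (hq (x + 1) (by linarith))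
      have := key x (y - c) (abs_le.2 ⟨by linarith [hy.1], by linarith [hy.2]⟩)
      rw [add_sub_cancel_right]
      linarith
    · refine le_trans (EReal.coe_le_coe_iff.2 ?_) (h.tangent_le (x + 1))
      rw [add_sub_cancel_right]
      nlinarith [mul_nonneg (neg_nonneg.2 hx) (sub_nonneg.2 hy.1)]
  · refine ⟨c - t, fun y hy => convexConj_le_coe fun x => ?_⟩
    rw [sub_add_cancel] at hy
    obtain hx | hx := le_total x 0
    · refine le_trans (EReal.coe_le_coe_iff.2 ?_) (hq (x + 1) (by linarith))
      have := key x (y - c) (abs_le.2 ⟨by linarith [hy.1], by linarith [hy.2]⟩)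
      rw [add_sub_cancel_right]
      linarith
    · refine le_trans (EReal.coe_le_coe_iff.2 ?_) (h.tangent_le (x + 1))
      rw [add_sub_cancel_right]
      nlinarith [mul_nonneg hx (sub_nonneg.2 hy.2)]

lemma HasOneSidedQuadraticBound.heightForWidth_le (h : HasOneSidedQuadraticBound φ c κ)
    {t : ℝ} (ht : 0 ≤ t) :
    heightForWidth (convexConj (shiftOne φ)) t ≤
      ENNReal.ofReal (t ^ 2) / ENNReal.ofReal (2 * κ) := by
  -- At `t = 0` even the empty set is wide enough. For `t > 0` and `κ ≤ 0` the right-hand side is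
  -- `⊤`, by division of a nonzero number by zero in `ℝ≥0∞`.
  obtain rfl | ht' := ht.eq_or_lt
  · refine (sInf_le (?_ : (0 : ℝ≥0∞) ∈ _)).trans zero_le
    simp
  obtain hκ | hκ := le_or_gt κ 0
  · rw [ENNReal.ofReal_of_nonpos (by linarith : 2 * κ ≤ 0),
      ENNReal.div_zero (ENNReal.ofReal_pos.2 (by positivity)).ne']
    exact le_top
  obtain ⟨a, ha⟩ := h.exists_Icc hκ ht
  rw [← ENNReal.ofReal_div_of_pos (by positivity)]
  refine sInf_le ?_
  calc ENNReal.ofReal t = volume (Icc a (a + t)) := by rw [Real.volume_Icc, add_sub_cancel_left]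
    _ ≤ _ := measure_mono fun y hy => by
      have := ha y hy
      rw [mem_ofPred_eq, EReal.coe_ennreal_ofReal, max_eq_left (by positivity)]
      exact this

end Conjugate

/-! ### Divergence against total variation -/

section Divergence

variable {Ω : Type*} [MeasurableSpace Ω]

lemma erealIntegral_mono {ν : Measure Ω} {f g : Ω → EReal} (h : ∀ ω, f ω ≤ g ω) :
    erealIntegral ν f ≤ erealIntegral ν g := by
  refine EReal.sub_le_sub ?_ ?_ <;> rw [EReal.coe_ennreal_le_coe_ennreal_iff]
  · exact lintegral_mono fun ω => EReal.toENNReal_le_toENNReal (h ω)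
  · exact lintegral_mono fun ω => EReal.toENNReal_le_toENNReal (EReal.neg_le_neg_iff.2 (h ω))

lemma erealIntegral_coe {ν : Measure Ω} {f : Ω → ℝ} (hf : Integrable f ν) :
    erealIntegral ν (fun ω => (f ω : EReal)) = ((∫ ω, f ω ∂ν : ℝ) : EReal) := by
  rw [integral_eq_lintegral_pos_part_sub_lintegral_neg_part hf, EReal.coe_sub,
    EReal.coe_ennreal_toReal hf.lintegral_lt_top.ne,
    EReal.coe_ennreal_toReal (x := ∫⁻ ω, ENNReal.ofReal (-f ω) ∂ν) hf.neg.lintegral_lt_top.ne]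
  rfl

lemma le_slopeAtTop {φ : ℝ → EReal} {c d : ℝ}
    (h : ∀ x : ℝ, 1 ≤ x → ((c * (x - 1) - d : ℝ) : EReal) ≤ φ x) :
    (c : EReal) ≤ slopeAtTop φ := by
  have hlim : Tendsto (fun x : ℝ => c - (c + d) * x⁻¹) atTop (𝓝 (c - (c + d) * 0)) :=
    tendsto_const_nhds.sub (tendsto_const_nhds.mul tendsto_inv_atTop_zero)
  rw [mul_zero, sub_zero] at hlim
  rw [← ((continuous_coe_real_ereal.tendsto c).comp hlim).limsup_eq]
  refine limsup_le_limsup ?_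
  filter_upwards [eventually_ge_atTop 1] with x hx
  have hx0 : 0 < x := by linarith
  have := EReal.div_le_div_right_of_nonneg (EReal.coe_nonneg.2 hx0.le) (h x hx)
  refine le_trans (le_of_eq ?_) this
  rw [← EReal.coe_div, Function.comp_apply]
  congr 1
  field_simp
  ring

/-- The mass by which `ν` exceeds `μ`, namely `∫ (1 - dμ_c/dν)⁺ dν`. -/
noncomputable def deficit (μ ν : Measure Ω) : ℝ := ∫ ω, max (1 - (μ.rnDeriv ν ω).toReal) 0 ∂ν

lemma deficit_nonneg (μ ν : Measure Ω) : 0 ≤ deficit μ ν :=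
  integral_nonneg fun _ => le_max_right _ _

section Probability

variable (μ ν : Measure Ω) [IsProbabilityMeasure μ] [IsProbabilityMeasure ν]

lemma integrable_max_one_sub_rnDeriv :
    Integrable (fun ω => max (1 - (μ.rnDeriv ν ω).toReal) 0) ν :=
  ((integrable_const 1).sub Measure.integrable_toReal_rnDeriv).pos_part

lemma integral_rnDeriv_sub_one :
    ∫ ω, ((μ.rnDeriv ν ω).toReal - 1) ∂ν = -(μ.singularPart ν).real univ := by
  rw [integral_sub Measure.integrable_toReal_rnDeriv (integrable_const 1),
    Measure.integral_toReal_rnDeriv']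
  simp

/-- The minorant has slope `c` at infinity, so the singular part contributes at least `c` times its
mass. This cancels the integral of `c (p - 1)`, with `p = dμ_c/dν`, which is `-c` times that mass
since `μ` and `ν` have equal total mass. -/
lemma le_phiDivergence_of_forall_le {φ : ℝ → EReal} {b c d : ℝ}
    (h : ∀ x : ℝ, ((c * (x - 1) + b * max (1 - x) 0 - d : ℝ) : EReal) ≤ φ x) :
    ((b * deficit μ ν - d : ℝ) : EReal) ≤ phiDivergence φ μ ν := by
  have hp : Integrable (fun ω => (μ.rnDeriv ν ω).toReal - 1) ν :=
    Measure.integrable_toReal_rnDeriv.sub (integrable_const 1)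
  have hq := integrable_max_one_sub_rnDeriv μ ν
  have hint := erealIntegral_mono (ν := ν) fun ω => h (μ.rnDeriv ν ω).toReal
  have hcb : Integrable (fun ω => c * ((μ.rnDeriv ν ω).toReal - 1) +
      b * max (1 - (μ.rnDeriv ν ω).toReal) 0) ν := (hp.const_mul c).add (hq.const_mul b)
  have hi : Integrable (fun ω => c * ((μ.rnDeriv ν ω).toReal - 1) +
      b * max (1 - (μ.rnDeriv ν ω).toReal) 0 - d) ν :=
    hcb.sub (integrable_const d)
  rw [erealIntegral_coe hi, integral_sub hcb (integrable_const d),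
    integral_add (hp.const_mul c) (hq.const_mul b), integral_const_mul, integral_const_mul,
    integral_rnDeriv_sub_one] at hint
  have hslope : (c : EReal) ≤ slopeAtTop φ := le_slopeAtTop fun x hx => by
    simpa [max_eq_right (by linarith : 1 - x ≤ 0)] using h x
  have hsing : (((μ.singularPart ν).real univ * c : ℝ) : EReal) ≤
      ((μ.singularPart ν univ : ℝ≥0∞) : EReal) * slopeAtTop φ := by
    rw [EReal.coe_mul, Measure.real, EReal.coe_ennreal_toReal (measure_ne_top _ _)]
    exact mul_le_mul_of_nonneg_left hslope (EReal.coe_ennreal_nonneg _)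
  refine le_trans (le_of_eq ?_) (add_le_add hint hsing)
  rw [← EReal.coe_add]
  congr 1
  simp only [deficit, integral_const, probReal_univ, one_smul]
  ring

/-- The singular part contributes at most its mass `m`, and the absolutely continuous part at most
`∫ |p - 1| dν`. Since `|p - 1| = 2 (1 - p)⁺ + (p - 1)`, the latter is twice the deficit minus `m`.
-/
lemma tvDistance_le : tvDistance μ ν ≤ ENNReal.ofReal (2 * deficit μ ν) := by
  refine iSup₂_le fun g hg => ENNReal.ofReal_le_ofReal ?_
  obtain ⟨hgm, hg1⟩ := hg
  have hg_abs : ∀ ω, ‖g ω‖ ≤ 1 := fun ω => abs_le.2 (hg1 ω)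
  have hgi : ∀ (ρ : Measure Ω) [IsFiniteMeasure ρ], Integrable g ρ := fun ρ _ =>
    Integrable.of_bound hgm.aestronglyMeasurable 1 (ae_of_all _ hg_abs)
  have hpi : Integrable (fun ω => (μ.rnDeriv ν ω).toReal) ν := Measure.integrable_toReal_rnDeriv
  have hp1 : Integrable (fun ω => (μ.rnDeriv ν ω).toReal - 1) ν := hpi.sub (integrable_const 1)
  have hpg : Integrable (fun ω => (μ.rnDeriv ν ω).toReal * g ω) ν :=
    hpi.mul_bdd (c := 1) hgm.aestronglyMeasurable (ae_of_all _ hg_abs)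
  have hμ : ∫ ω, g ω ∂μ =
      ∫ ω, g ω ∂(μ.singularPart ν) + ∫ ω, (μ.rnDeriv ν ω).toReal * g ω ∂ν := by
    conv_lhs => rw [← μ.singularPart_add_rnDeriv ν]
    rw [integral_add_measure (hgi _) (hgi _),
      integral_withDensity_eq_integral_toReal_smul (Measure.measurable_rnDeriv μ ν)
        (Measure.rnDeriv_lt_top μ ν)]
    rfl
  have hs : |∫ ω, g ω ∂(μ.singularPart ν)| ≤ (μ.singularPart ν).real univ := by
    simpa using norm_integral_le_of_norm_le_const (μ := μ.singularPart ν) (ae_of_all _ hg_abs)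
  have hq := integrable_max_one_sub_rnDeriv μ ν
  have hc : |∫ ω, (μ.rnDeriv ν ω).toReal * g ω ∂ν - ∫ ω, g ω ∂ν| ≤
      2 * deficit μ ν - (μ.singularPart ν).real univ := by
    rw [← integral_sub hpg (hgi ν), deficit, ← integral_const_mul, sub_eq_add_neg,
      ← integral_rnDeriv_sub_one, ← integral_add (hq.const_mul 2) hp1]
    refine norm_integral_le_of_norm_le (G := ℝ) ((hq.const_mul 2).add hp1)
      (ae_of_all _ fun ω => ?_)
    set p := (μ.rnDeriv ν ω).toReal
    have h2 : 2 * max (1 - p) 0 + (p - 1) = |p - 1| := by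
      rcases le_total p 1 with h | h
      · rw [max_eq_left (by linarith), abs_of_nonpos (by linarith)]; ring
      · rw [max_eq_right (by linarith), abs_of_nonneg (by linarith)]; ring
    change ‖p * g ω - g ω‖ ≤ 2 * max (1 - p) 0 + (p - 1)
    rw [h2, show p * g ω - g ω = (p - 1) * g ω by ring, norm_mul]
    exact mul_le_of_le_one_right (abs_nonneg _) (hg_abs ω)
  rw [hμ, add_sub_assoc]
  linarith [abs_add_le (∫ ω, g ω ∂(μ.singularPart ν))
    (∫ ω, (μ.rnDeriv ν ω).toReal * g ω ∂ν - ∫ ω, g ω ∂ν)]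

lemma HasOneSidedQuadraticBound.sq_deficit_le {φ : ℝ → EReal} {c κ : ℝ}
    (h : HasOneSidedQuadraticBound φ c κ) (hκ : 0 ≤ κ) :
    ((κ / 2 * deficit μ ν ^ 2 : ℝ) : EReal) ≤ phiDivergence φ μ ν := by
  set u := deficit μ ν with hu
  have hu0 : 0 ≤ u := deficit_nonneg μ ν
  have hd : 0 ≤ κ / 2 * u ^ 2 := by positivity
  -- The tangent to `κ/2 r^2` at `r = u` is `κ u r - κ/2 u^2`, whence `b = κ u` and `d = κ/2 u^2`.
  -- If the parabola lies to the right of `1`, raising the slope to `c + κ u` puts the kink there,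
  -- because `r = (r)⁺ - (-r)⁺`.
  have hval : κ / 2 * u ^ 2 = κ * u * deficit μ ν - κ / 2 * u ^ 2 := by rw [← hu]; ring
  have hκu : 0 ≤ κ * u := by positivity
  rw [hval]
  obtain hq | hq := h.parabola_le
  · refine le_phiDivergence_of_forall_le μ ν (c := c + κ * u) fun x => ?_
    obtain hx | hx := le_total 1 x
    · refine le_trans (EReal.coe_le_coe_iff.2 ?_) (hq x hx)
      rw [max_eq_right (by linarith)]
      nlinarith [mul_nonneg hκ (sq_nonneg (x - 1 - u))]
    · refine le_trans (EReal.coe_le_coe_iff.2 ?_) (h.tangent_le x)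
      rw [max_eq_left (by linarith)]
      linarith
  · refine le_phiDivergence_of_forall_le μ ν (c := c) fun x => ?_
    obtain hx | hx := le_total x 1
    · refine le_trans (EReal.coe_le_coe_iff.2 ?_) (hq x hx)
      rw [max_eq_left (by linarith)]
      nlinarith [mul_nonneg hκ (sq_nonneg (1 - x - u))]
    · refine le_trans (EReal.coe_le_coe_iff.2 ?_) (h.tangent_le x)
      rw [max_eq_right (by linarith)]
      linarith

lemma HasOneSidedQuadraticBound.sq_tvDistance_le {φ : ℝ → EReal} {c κ : ℝ}
    (h : HasOneSidedQuadraticBound φ c κ) :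
    ((ENNReal.ofReal (κ / 8) * tvDistance μ ν ^ 2 : ℝ≥0∞) : EReal) ≤ phiDivergence φ μ ν := by
  obtain hκ | hκ := le_or_gt κ 0
  · rw [ENNReal.ofReal_of_nonpos (by linarith), zero_mul, EReal.coe_ennreal_zero]
    simpa using le_phiDivergence_of_forall_le μ ν (b := 0) (c := c) (d := 0)
      (fun x => by simpa using h.tangent_le x)
  refine le_trans ?_ (h.sq_deficit_le μ ν hκ.le)
  have hu := deficit_nonneg μ ν
  calc ((ENNReal.ofReal (κ / 8) * tvDistance μ ν ^ 2 : ℝ≥0∞) : EReal)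
      ≤ ((ENNReal.ofReal (κ / 8) * ENNReal.ofReal (2 * deficit μ ν) ^ 2 : ℝ≥0∞) : EReal) := by
        rw [EReal.coe_ennreal_le_coe_ennreal_iff]
        gcongr
        exact tvDistance_le μ ν
    _ = ((κ / 2 * deficit μ ν ^ 2 : ℝ) : EReal) := by
        rw [← ENNReal.ofReal_pow (by positivity), ← ENNReal.ofReal_mul (by positivity),
          EReal.coe_ennreal_ofReal, max_eq_left (by positivity)]
        congr 1
        ring

end Probability

end Divergence

/-! ### The `α`-divergences -/

section AlphaDivergence

/-- The real-valued function that `alphaGenerator α` restricts to on the positive half-line. -/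
noncomputable def alphaReal (α x : ℝ) : ℝ :=
  if α = 0 then x - 1 - Real.log x
  else if α = 1 then x * Real.log x - x + 1
  else (x ^ α - α * (x - 1) - 1) / (α * (α - 1))

/-- The derivative of `alphaReal α` on the positive half-line. -/
noncomputable def alphaRealDeriv (α x : ℝ) : ℝ :=
  if α = 1 then Real.log x else (x ^ (α - 1) - 1) / (α - 1)

lemma hasDerivAt_alphaReal (α : ℝ) {x : ℝ} (hx : 0 < x) :
    HasDerivAt (alphaReal α) (alphaRealDeriv α x) x := by
  by_cases h0 : α = 0
  · subst h0
    have h := ((hasDerivAt_id x).sub_const 1).sub (Real.hasDerivAt_log hx.ne')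
    refine (h.congr_deriv ?_).congr_of_eventuallyEq (Eventually.of_forall fun y => ?_)
    · simp [alphaRealDeriv, Real.rpow_neg_one, div_neg]
    · simp [alphaReal]
  by_cases h1 : α = 1
  · subst h1
    have h := ((Real.hasDerivAt_mul_log hx.ne').sub (hasDerivAt_id x)).add_const 1
    refine (h.congr_deriv ?_).congr_of_eventuallyEq (Eventually.of_forall fun y => ?_)
    · simp [alphaRealDeriv]
    · simp [alphaReal]
  have h1' : α - 1 ≠ 0 := sub_ne_zero.2 h1
  have h := (((Real.hasDerivAt_rpow_const (p := α) (Or.inl hx.ne')).sub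
    (((hasDerivAt_id x).sub_const 1).const_mul α)).sub_const 1).div_const (α * (α - 1))
  refine (h.congr_deriv ?_).congr_of_eventuallyEq (Eventually.of_forall fun y => ?_)
  · simp only [alphaRealDeriv, h1, if_false]
    field_simp
  · simp [alphaReal, h0, h1]

lemma hasDerivAt_alphaRealDeriv (α : ℝ) {x : ℝ} (hx : 0 < x) :
    HasDerivAt (alphaRealDeriv α) (x ^ (α - 2)) x := by
  by_cases h1 : α = 1
  · subst h1
    refine ((Real.hasDerivAt_log hx.ne').congr_deriv ?_).congr_of_eventuallyEq
      (Eventually.of_forall fun y => ?_)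
    · norm_num [Real.rpow_neg_one]
    · simp [alphaRealDeriv]
  have h1' : α - 1 ≠ 0 := sub_ne_zero.2 h1
  have h := ((Real.hasDerivAt_rpow_const (p := α - 1) (Or.inl hx.ne')).sub_const 1).div_const
    (α - 1)
  refine (h.congr_deriv ?_).congr_of_eventuallyEq (Eventually.of_forall fun y => ?_)
  · rw [mul_div_cancel_left₀ _ h1']; congr 1; ring
  · simp [alphaRealDeriv, h1]

lemma sq_le_alphaReal {α x κ : ℝ} (hx : 0 < x) (hκ : ∀ y ∈ uIcc 1 x, κ ≤ y ^ (α - 2)) :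
    κ / 2 * (x - 1) ^ 2 ≤ alphaReal α x := by
  have hpos : ∀ y ∈ uIcc 1 x, 0 < y := fun y hy => (lt_min one_pos hx).trans_le hy.1
  have h := quadratic_lower_bound_of_deriv2_ge (fun y hy => hasDerivAt_alphaReal α (hpos y hy))
    (fun y hy => hasDerivAt_alphaRealDeriv α (hpos y hy)) hκ
  have e1 : alphaReal α 1 = 0 := by unfold alphaReal; split_ifs <;> simp
  have e2 : alphaRealDeriv α 1 = 0 := by unfold alphaRealDeriv; split_ifs <;> simp
  simpa [e1, e2] using h

lemma coe_le_alphaGenerator {α x b : ℝ} (hpos : 0 < x → b ≤ alphaReal α x)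
    (hzero : x = 0 → 0 < α → b ≤ α⁻¹) : (b : EReal) ≤ alphaGenerator α x := by
  obtain hx | rfl | hx := lt_trichotomy x 0
  · simp [alphaGenerator, hx]
  · obtain hα | hα := le_or_gt α 0
    · simp [alphaGenerator, hα]
    · have hb := hzero rfl hα
      by_cases h1 : α = 1
      · subst h1
        simpa [alphaGenerator, (zero_lt_one' ℝ).not_ge] using EReal.coe_le_coe_iff.2 hb
      · have h1' : α - 1 ≠ 0 := sub_ne_zero.2 h1
        have e : ((0 : ℝ) ^ α - α * (0 - 1) - 1) / (α * (α - 1)) = α⁻¹ := by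
          rw [Real.zero_rpow hα.ne']; field_simp; ring
        simp only [alphaGenerator, lt_irrefl, hα.not_ge, and_false, or_self, if_false, hα.ne', h1, e]
        exact EReal.coe_le_coe_iff.2 hb
  · have e : alphaGenerator α x = (alphaReal α x : EReal) := by
      simp only [alphaGenerator, alphaReal, hx.not_gt, hx.ne', false_and, or_self, if_false]
      split_ifs <;> rfl
    rw [e]
    exact EReal.coe_le_coe_iff.2 (hpos hx)

/-- The second derivative `x^(α - 2)` is at least `1` on `[1, ∞)` when `α ≥ 2`, and on `(0, 1]` when
`α ≤ 2`. -/
lemma alphaGenerator_hasOneSidedQuadraticBound (α : ℝ) :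
    HasOneSidedQuadraticBound (alphaGenerator α) 0 1 := by
  refine ⟨fun x => ?_, ?_⟩
  · refine coe_le_alphaGenerator (fun hx => ?_) fun _ hα => ?_
    · have := sq_le_alphaReal (α := α) (κ := 0) hx fun y hy =>
        Real.rpow_nonneg ((lt_min one_pos hx).le.trans hy.1) _
      linarith
    · rw [zero_mul]; positivity
  obtain hα2 | hα2 := le_total 2 α
  · refine Or.inl fun x hx1 => coe_le_alphaGenerator (fun hx => ?_) fun hx => by linarith
    rw [zero_mul, zero_add]
    refine sq_le_alphaReal hx fun y hy => ?_
    rw [uIcc_of_le hx1] at hy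
    exact Real.one_le_rpow hy.1 (by linarith)
  · refine Or.inr fun x hx1 => coe_le_alphaGenerator (fun hx => ?_) fun hx hα => ?_
    · rw [zero_mul, zero_add]
      refine sq_le_alphaReal hx fun y hy => ?_
      rw [uIcc_of_ge hx1] at hy
      exact Real.one_le_rpow_of_pos_of_le_one_of_nonpos (hx.trans_le hy.1) hy.2 (by linarith)
    -- At `x = 0` the parabola has height `1/2`, and `1/α ≥ 1/2` because `α ≤ 2`.
    · subst hx
      have := inv_anti₀ hα hα2
      norm_num at this ⊢
      linarith

end AlphaDivergence


theorem mainTheorem10 {Ω : Type*} [MeasurableSpace Ω] :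
    (∀ φ : ℝ → EReal, IsDivergenceGenerator φ →
      (1 : ℝ) ∈ interior (effDom φ) →
      TwiceDifferentiableOnDom φ →
      (MonotoneOn (secondDeriv φ) (interior (effDom φ)) ∨
        AntitoneOn (secondDeriv φ) (interior (effDom φ))) →
      (∀ t : ℝ, 0 ≤ t →
        heightForWidth (convexConj (shiftOne φ)) t ≤
          ENNReal.ofReal (t ^ 2) / ENNReal.ofReal (2 * secondDeriv φ 1)) ∧
      (∀ (μ ν : Measure Ω) [IsProbabilityMeasure μ] [IsProbabilityMeasure ν],
        ((ENNReal.ofReal (secondDeriv φ 1 / 8) * tvDistance μ ν ^ 2 : ℝ≥0∞) : EReal) ≤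
          phiDivergence φ μ ν)) ∧
    (∀ (α : ℝ) (μ ν : Measure Ω) [IsProbabilityMeasure μ] [IsProbabilityMeasure ν],
      ((1 / 8 * tvDistance μ ν ^ 2 : ℝ≥0∞) : EReal) ≤
        phiDivergence (alphaGenerator α) μ ν) := by
  refine ⟨fun φ hφ h1 hd hm => ?_, fun α μ ν _ _ => ?_⟩
  · have h := hφ.hasOneSidedQuadraticBound h1 hd hm
    exact ⟨fun t ht => h.heightForWidth_le ht, fun μ ν _ _ => h.sq_tvDistance_le μ ν⟩
  · have h := (alphaGenerator_hasOneSidedQuadraticBound α).sq_tvDistance_le μ ν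
    rwa [ENNReal.ofReal_div_of_pos (by norm_num), ENNReal.ofReal_one, ENNReal.ofReal_ofNat] at h
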